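/- **Theorem 1.1.** Let $m\ge 1$ and $n\ge 0$ be integers, let $[m]=\{0,1,\dots,m-1\}$, and let $$V^m=\Big\{x=(x_0,\dots,x_{m-1})\in\mathbb R^m : \sum_{i=0}^{m-1}x_i=0,\ x_0\le x_1\le\cdots\le x_{m-1}\Big\}.$$ A letter $i\in[m]$ acts on $x\in V^m$ by adding $m$ to the coordinate $x_i$, subtracting $(1,1,\dots,1)$, and then re-sorting the coordinates into weakly increasing order. A word $w=w_0w_1\cdots w_{n-1}\in[m]^n$ acts on $V^m$ by letting its letters act from left to right; let $\mathrm{Fix}(w)=\{x\in V^m : w(x)=x\}$. The word $w$ is an $(m,n)$-parking word if $$\big|\{j : w_j<i\}\big|\ \ge\ \frac{in}{m}\qquad\text{for all } 1\le i\le m.$$ Then for every $w\in[m]^n$, the action of $w$ on $V^m$ has a fixed point if and only if $w$ is an $(m,n)$-parking word. More precisely, the action of $w$ on $V^m$ - has a unique fixed point if and only if $w$ is an $(m,n)$-parking word and $\gcd(m,n)=1$; - has infinitely many fixed points if and only if $w$ is an $(m,n)$-parking word and $\gcd(m,n)>1$; - has no fixed points if and only if $w$ is not an $(m,n)$-parking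 word. Moreover, if $w$ is an $(m,n)$-parking word, then $\mathrm{Fix}(w)$ has affine dimension $\gcd(m,n)-1$; that is, $\mathrm{Fix}(w)$ is convex, and there is an affine subspace of $\mathbb R^m$ of dimension $\gcd(m,n)-1$ that contains $\mathrm{Fix}(w)$ and in which $\mathrm{Fix}(w)$ contains a (nonempty) open ball. -/

import Mathlib

namespace ParkingWords

/-- The increasing rearrangement of a real `m`-tuple. -/
noncomputable def sortTuple {m : ℕ} (x : Fin m → ℝ) : Fin m → ℝ :=
  x ∘ Tuple.sort x

/-- The sorted sum-zero cone `V^m` in `ℝ^m`. -/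
def cone (m : ℕ) : Set (Fin m → ℝ) :=
  {x | ∑ i, x i = 0 ∧ Monotone x}

/-- The action of a letter `i ∈ [m] = {0, …, m-1}`: add `m` to the `i`-th coordinate, subtract
`(1, …, 1)`, then re-sort. -/
noncomputable def letterAct {m : ℕ} (i : Fin m) (x : Fin m → ℝ) : Fin m → ℝ :=
  sortTuple (x + Pi.single i (m : ℝ) - 1)

/-- The letters map the cone `V^m` to itself, so `letterAct` really is an action on `V^m`. -/
theorem letterAct_mem_cone {m : ℕ} (i : Fin m) {x : Fin m → ℝ} (hx : x ∈ cone m) :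
    letterAct i x ∈ cone m := by
  refine ⟨?_, Tuple.monotone_sort _⟩
  have h : ∀ y : Fin m → ℝ, ∑ j, sortTuple y j = ∑ j, y j := fun y =>
    Equiv.sum_comp (Tuple.sort y) y
  rw [letterAct, h]
  simp [Finset.sum_add_distrib, Finset.sum_sub_distrib, hx.1]

/-- The action of a word `w = w₀ w₁ ⋯ w_{n-1} ∈ [m]^n`: its letters act from left to right. -/
noncomputable def wordAct {m n : ℕ} (w : Fin n → Fin m) (x : Fin m → ℝ) : Fin m → ℝ :=
  (List.ofFn w).foldl (fun y i => letterAct i y) x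

theorem wordAct_mem_cone {m n : ℕ} (w : Fin n → Fin m) {x : Fin m → ℝ} (hx : x ∈ cone m) :
    wordAct w x ∈ cone m := by
  unfold wordAct
  generalize List.ofFn w = l
  induction l generalizing x with
  | nil => exact hx
  | cons a l ih => exact ih (letterAct_mem_cone a hx)

/-- The set of fixed points of the action of `w` on the cone `V^m`. -/
def Fix {m n : ℕ} (w : Fin n → Fin m) : Set (Fin m → ℝ) :=
  {x | x ∈ cone m ∧ wordAct w x = x}

/-- `w ∈ [m]^n` is an `(m,n)`-parking word: `|{j : w_j < i}| ≥ i n / m` for `1 ≤ i ≤ m`. -/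
def IsParkingWord {m n : ℕ} (w : Fin n → Fin m) : Prop :=
  ∀ i : ℕ, 1 ≤ i → i ≤ m →
    (i : ℝ) * (n : ℝ) / (m : ℝ) ≤ ((Finset.univ.filter fun j : Fin n => (w j : ℕ) < i).card : ℝ)

/-- `X` is of affine dimension `k`: it is a convex set, contained in an affine subspace of
dimension `k`, and it contains an open (Euclidean) ball of that affine subspace. -/
def HasAffineDim {m : ℕ} (X : Set (Fin m → ℝ)) (k : ℕ) : Prop :=
  Convex ℝ X ∧
  ∃ A : AffineSubspace ℝ (Fin m → ℝ),
    Module.finrank ℝ A.direction = k ∧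
    X ⊆ (A : Set (Fin m → ℝ)) ∧
    ∃ c ∈ A, ∃ r : ℝ, 0 < r ∧ ∀ y ∈ A, ∑ i, (y i - c i) ^ 2 < r ^ 2 → y ∈ X

end ParkingWords

/-! Sorting is nonexpansive for the Euclidean norm, hence so is every word. Therefore fixed points
form a convex set, and the centroid of any periodic orbit is fixed (`exists_fixed_of_periodic`).

A letter `a` raises the sum of the `i` smallest coordinates by at most `m·[a < i] - i`; adding up
over a word that returns to its starting point gives the parking inequalities. Conversely, for a
parking word these sums stay above a fixed bound along the orbit of `0` (`act_lowerSum_bound`), so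
this integral orbit is bounded, repeats a value, and yields a fixed point.

For the dimension, follow labelled coordinates: each letter lifts one of them by `m` and lowers all
by `1`, so congruence modulo `m` between labels never changes. At a fixed point with pairwise
incongruent coordinates no ties ever arise, so all nearby points make the same jumps and the word
permutes the displacement by some `σ` (`exists_perm_act_add`). As `σ` shifts residues by `-n`, its
cycles all have length `m / gcd`; there are `gcd` of them, and the invariant displacements of sum
zero have dimension `gcd - 1`. Convexity carries this local picture to all of `Fix w`.

Such a fixed point is reached by removing congruences step by step
(`exists_fixed_fewer_congruences`): a coordinate that comes last in every tie can be chosen to run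
through a cycle meeting each residue class at most once, and the coordinates on this cycle can all
be raised by the same small `ε`. -/

namespace ParkingWords

open Finset Filter Topology

variable {m n : ℕ}

/-! ### Sorting tuples -/

theorem monotone_sortTuple (x : Fin m → ℝ) : Monotone (sortTuple x) := Tuple.monotone_sort x

theorem sortTuple_comp_perm (x : Fin m → ℝ) (σ : Equiv.Perm (Fin m)) :
    sortTuple (x ∘ σ) = sortTuple x :=
  Tuple.comp_perm_comp_sort_eq_comp_sort

theorem sortTuple_eq_comp {x : Fin m → ℝ} {σ : Equiv.Perm (Fin m)} (h : Monotone (x ∘ σ)) :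
    sortTuple x = x ∘ σ :=
  (Tuple.comp_sort_eq_comp_iff_monotone.2 h).symm

theorem sortTuple_eq_self {x : Fin m → ℝ} (h : Monotone x) : sortTuple x = x :=
  sortTuple_eq_comp (σ := 1) h

theorem sum_sortTuple (x : Fin m → ℝ) : ∑ i, sortTuple x i = ∑ i, x i :=
  Equiv.sum_comp (Tuple.sort x) x

theorem card_sortTuple_le (x : Fin m → ℝ) (t : ℝ) :
    #{i | sortTuple x i ≤ t} = #{i | x i ≤ t} :=
  card_equiv (Tuple.sort x) fun i => by simp only [mem_filter, mem_univ, true_and]; rfl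

/-- Reduces comparisons of sorted tuples to counting sublevel sets, which do not see the order of
the coordinates. -/
theorem sortTuple_le_iff (x : Fin m → ℝ) (k : Fin m) (t : ℝ) :
    sortTuple x k ≤ t ↔ (k : ℕ) < #{i | x i ≤ t} := by
  rw [← card_sortTuple_le, Tuple.lt_card_le_iff_apply_le_of_monotone (monotone_sortTuple x)]

theorem sortTuple_mono {x y : Fin m → ℝ} (h : x ≤ y) : sortTuple x ≤ sortTuple y := by
  intro k
  rw [sortTuple_le_iff]
  refine ((sortTuple_le_iff y k _).1 le_rfl).trans_le (card_le_card ?_)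
  exact monotone_filter_right _ fun i _ hi => (h i).trans hi

theorem sortTuple_congr {x y : Fin m → ℝ} (h : ∀ t, #{i | x i ≤ t} = #{i | y i ≤ t}) :
    sortTuple x = sortTuple y := by
  funext k
  apply le_antisymm
  · rw [sortTuple_le_iff, h, ← sortTuple_le_iff]
  · rw [sortTuple_le_iff, ← h, ← sortTuple_le_iff]

theorem exists_perm_of_sortTuple_eq {x y : Fin m → ℝ} (h : sortTuple x = sortTuple y) :
    ∃ σ : Equiv.Perm (Fin m), x = y ∘ σ := by
  refine ⟨(Tuple.sort x).symm.trans (Tuple.sort y), ?_⟩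
  funext i
  have := congrFun h ((Tuple.sort x).symm i)
  simpa [sortTuple] using this

theorem sortTuple_add_const (x : Fin m → ℝ) (t : ℝ) :
    sortTuple (fun i => x i + t) = fun i => sortTuple x i + t := by
  rw [sortTuple_eq_comp (σ := Tuple.sort x)]
  · rfl
  · intro i j hij
    simpa using Tuple.monotone_sort x hij

/-- Rearrangement inequality: sorting preserves both norms and can only increase the inner product.
-/
theorem sum_sq_sortTuple_sub_le (x y : Fin m → ℝ) :
    ∑ i, (sortTuple x i - sortTuple y i) ^ 2 ≤ ∑ i, (x i - y i) ^ 2 := by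
  have hexp : ∀ u v : Fin m → ℝ,
      ∑ i, (u i - v i) ^ 2 = ∑ i, u i ^ 2 + ∑ i, v i ^ 2 - 2 * ∑ i, u i * v i := by
    intro u v
    rw [mul_sum, ← sum_add_distrib, ← sum_sub_distrib]
    exact sum_congr rfl fun i _ => by ring
  have hsq : ∀ u : Fin m → ℝ, ∑ i, sortTuple u i ^ 2 = ∑ i, u i ^ 2 := fun u =>
    Equiv.sum_comp (Tuple.sort u) fun i => u i ^ 2
  have hmono : Monovary (sortTuple x) (sortTuple y) :=
    (monotone_sortTuple x).monovary (monotone_sortTuple y)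
  have key := hmono.sum_mul_comp_perm_le_sum_mul
    (σ := (Tuple.sort x).trans (Tuple.sort y).symm)
  have hxy : ∑ i, sortTuple x i * sortTuple y (((Tuple.sort x).trans (Tuple.sort y).symm) i)
      = ∑ i, x i * y i := by
    rw [← Equiv.sum_comp (Tuple.sort x) fun i => x i * y i]
    simp [sortTuple]
  rw [hexp, hexp, hsq, hsq]
  linarith

/-! ### Words as lists of letters -/

/-- The action of a list of letters. -/
noncomputable def act (l : List (Fin m)) (x : Fin m → ℝ) : Fin m → ℝ :=
  l.foldl (fun y i => letterAct i y) x

@[simp] theorem act_nil (x : Fin m → ℝ) : act [] x = x := rfl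

@[simp] theorem act_cons (a : Fin m) (l : List (Fin m)) (x : Fin m → ℝ) :
    act (a :: l) x = act l (letterAct a x) := rfl

theorem wordAct_eq_act (w : Fin n → Fin m) (x : Fin m → ℝ) :
    wordAct w x = act (List.ofFn w) x := rfl

theorem act_mem_cone (l : List (Fin m)) {x : Fin m → ℝ} (hx : x ∈ cone m) :
    act l x ∈ cone m := by
  induction l generalizing x with
  | nil => exact hx
  | cons a l ih => exact ih (letterAct_mem_cone a hx)

theorem letterAct_add_const (a : Fin m) (x : Fin m → ℝ) (t : ℝ) :
    letterAct a (fun i => x i + t) = fun i => letterAct a x i + t := by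
  rw [letterAct, letterAct, ← sortTuple_add_const]
  congr 1
  funext i
  simp only [Pi.add_apply, Pi.sub_apply, Pi.one_apply]
  ring

theorem act_add_const (l : List (Fin m)) (x : Fin m → ℝ) (t : ℝ) :
    act l (fun i => x i + t) = fun i => act l x i + t := by
  induction l generalizing x with
  | nil => rfl
  | cons a l ih => rw [act_cons, letterAct_add_const, ih, act_cons]

theorem sum_sq_act_sub_le (l : List (Fin m)) (x y : Fin m → ℝ) :
    ∑ i, (act l x i - act l y i) ^ 2 ≤ ∑ i, (x i - y i) ^ 2 := by
  induction l generalizing x y with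
  | nil => exact le_rfl
  | cons a l ih =>
    refine (ih _ _).trans ((sum_sq_sortTuple_sub_le _ _).trans_eq ?_)
    exact sum_congr rfl fun i _ => by
      simp only [Pi.add_apply, Pi.sub_apply, Pi.one_apply]; ring

/-! ### Convexity of the fixed-point set and centroids of periodic orbits -/

theorem convex_cone (m : ℕ) : Convex ℝ (cone m) := by
  intro x hx y hy s t hs ht hst
  refine ⟨?_, ?_⟩
  · have : ∑ i, (s • x + t • y) i = s * ∑ i, x i + t * ∑ i, y i := by
      simp [sum_add_distrib, mul_sum]
    rw [this, hx.1, hy.1]; simp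
  · intro i j hij
    have h1 := mul_le_mul_of_nonneg_left (hx.2 hij) hs
    have h2 := mul_le_mul_of_nonneg_left (hy.2 hij) ht
    simpa using add_le_add h1 h2

theorem eq_of_sum_sq_sub_nonpos {x y : Fin m → ℝ} (h : ∑ i, (x i - y i) ^ 2 ≤ 0) : x = y := by
  have h0 : ∑ i, (x i - y i) ^ 2 = 0 := le_antisymm h (sum_nonneg fun i _ => sq_nonneg _)
  rw [sum_eq_zero_iff_of_nonneg fun i _ => sq_nonneg _] at h0
  funext i
  have := h0 i (mem_univ i)
  rw [sq_eq_zero_iff] at this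
  linarith

/-- The image `p` of `z` is no farther from `x` and `y` than `z` is; by the Euclidean identity `h3`
this leaves only `p = z`. -/
theorem act_convex_combination {l : List (Fin m)} {x y : Fin m → ℝ} (hx : act l x = x)
    (hy : act l y = y) {s t : ℝ} (hs : 0 ≤ s) (ht : 0 ≤ t) (hst : s + t = 1) :
    act l (s • x + t • y) = s • x + t • y := by
  set z := s • x + t • y with hz
  set p := act l z
  apply eq_of_sum_sq_sub_nonpos
  have h1 : ∑ i, (p i - x i) ^ 2 ≤ ∑ i, (z i - x i) ^ 2 := by
    have := sum_sq_act_sub_le l z x; rwa [hx] at this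
  have h2 : ∑ i, (p i - y i) ^ 2 ≤ ∑ i, (z i - y i) ^ 2 := by
    have := sum_sq_act_sub_le l z y; rwa [hy] at this
  have h3 : ∑ i, (p i - z i) ^ 2 = s * ∑ i, (p i - x i) ^ 2 + t * ∑ i, (p i - y i) ^ 2
      - s * ∑ i, (z i - x i) ^ 2 - t * ∑ i, (z i - y i) ^ 2 := by
    simp only [mul_sum, ← sum_add_distrib, ← sum_sub_distrib]
    refine sum_congr rfl fun i _ => ?_
    have : z i = s * x i + t * y i := by simp [hz]
    rw [this, show s = 1 - t by linarith]
    ring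
  have h4 := mul_le_mul_of_nonneg_left h1 hs
  have h5 := mul_le_mul_of_nonneg_left h2 ht
  linarith

theorem convex_Fix (w : Fin n → Fin m) : Convex ℝ (Fix w) := fun _ hx _ hy _ _ hs ht hst =>
  ⟨convex_cone m hx.1 hy.1 hs ht hst, act_convex_combination hx.2 hy.2 hs ht hst⟩

/-- The centroid of a periodic orbit is a fixed point. -/
theorem exists_fixed_of_periodic {l : List (Fin m)} {u : Fin m → ℝ} (hu : u ∈ cone m) {p : ℕ}
    (hp : 0 < p) (hper : (act l)^[p] u = u) : ∃ x ∈ cone m, act l x = x := by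
  have hp' : (0 : ℝ) < p := by exact_mod_cast hp
  have hmem : ∀ k, (act l)^[k] u ∈ cone m := by
    intro k
    induction k with
    | zero => exact hu
    | succ k ih => rw [Function.iterate_succ_apply']; exact act_mem_cone l ih
  have hshift : ∀ g : (Fin m → ℝ) → ℝ,
      ∑ k ∈ range p, g ((act l)^[k + 1] u) = ∑ k ∈ range p, g ((act l)^[k] u) := by
    intro g
    have h1 := sum_range_succ (fun k => g ((act l)^[k] u)) p
    have h2 := sum_range_succ' (fun k => g ((act l)^[k] u)) p
    rw [hper] at h1
    simp only [Function.iterate_zero, id] at h2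
    linarith
  set c : Fin m → ℝ := fun i => (∑ k ∈ range p, (act l)^[k] u i) / p with hc
  have hcsum : ∀ i, ∑ k ∈ range p, (act l)^[k] u i = p * c i := by
    intro i; simp only [hc]; field_simp
  -- The centroid is the only minimizer of the total squared distance to the orbit, and `act l c`
  -- does at least as well because `act l` permutes the orbit.
  have hcent : ∀ q : Fin m → ℝ, ∑ k ∈ range p, ∑ i, (q i - (act l)^[k] u i) ^ 2
      = ∑ k ∈ range p, ∑ i, (c i - (act l)^[k] u i) ^ 2 + p * ∑ i, (q i - c i) ^ 2 := by
    intro q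
    rw [sum_comm, sum_comm (s := range p), mul_sum, ← sum_add_distrib]
    refine sum_congr rfl fun i _ => ?_
    have : ∀ k, (q i - (act l)^[k] u i) ^ 2 = (c i - (act l)^[k] u i) ^ 2
        + (q i - c i) * (q i + c i) - 2 * (q i - c i) * (act l)^[k] u i := by intro k; ring
    simp only [this, sum_add_distrib, sum_sub_distrib, ← mul_sum, hcsum, sum_const, card_range,
      nsmul_eq_mul]
    ring
  refine ⟨c, ⟨?_, ?_⟩, ?_⟩
  · simp only [hc]
    rw [← sum_div, sum_comm, sum_eq_zero fun k _ => (hmem k).1, zero_div]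
  · intro i j hij
    exact div_le_div_of_nonneg_right (sum_le_sum fun k _ => (hmem k).2 hij) hp'.le
  · apply eq_of_sum_sq_sub_nonpos
    have h1 := hcent (act l c)
    have h2 := hshift fun v => ∑ i, (act l c i - v i) ^ 2
    have h3 : ∑ k ∈ range p, ∑ i, (act l c i - (act l)^[k + 1] u i) ^ 2
        ≤ ∑ k ∈ range p, ∑ i, (c i - (act l)^[k] u i) ^ 2 := by
      refine sum_le_sum fun k _ => ?_
      rw [Function.iterate_succ_apply']
      exact sum_sq_act_sub_le l _ _
    have h4 : (p : ℝ) * ∑ i, (act l c i - c i) ^ 2 ≤ 0 := by linarith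
    by_contra hneg
    push Not at hneg
    exact absurd h4 (not_le.2 (mul_pos hp' hneg))

/-! ### Sums of the smallest coordinates -/

/-- The sum of the first `i` coordinates. -/
noncomputable def lowerSum (i : ℕ) (x : Fin m → ℝ) : ℝ :=
  ∑ j : Fin m, if (j : ℕ) < i then x j else 0

theorem lowerSum_mono (i : ℕ) {x y : Fin m → ℝ} (h : x ≤ y) : lowerSum i x ≤ lowerSum i y :=
  sum_le_sum fun j _ => by split_ifs <;> simp [h j]

theorem lowerSum_zero (x : Fin m → ℝ) : lowerSum 0 x = 0 := by simp [lowerSum]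

theorem lowerSum_full (x : Fin m → ℝ) : lowerSum m x = ∑ j, x j := by simp [lowerSum]

theorem lowerSum_succ {i : ℕ} (hi : i < m) (x : Fin m → ℝ) :
    lowerSum (i + 1) x = lowerSum i x + x ⟨i, hi⟩ := by
  have : x ⟨i, hi⟩ = ∑ j : Fin m, if j = ⟨i, hi⟩ then x j else 0 := by simp
  rw [lowerSum, lowerSum, this, ← sum_add_distrib]
  refine sum_congr rfl fun j _ => ?_
  have : j = ⟨i, hi⟩ ↔ (j : ℕ) = i := by rw [Fin.ext_iff]
  simp only [this]
  rcases lt_trichotomy (j : ℕ) i with h | h | h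
  · simp [h, h.ne, h.trans (Nat.lt_succ_self i)]
  · simp [h]
  · simp [not_lt.2 h.le, h.ne', not_lt.2 (Nat.succ_le_of_lt h)]

theorem sum_ite_lt_const {i : ℕ} (hi : i ≤ m) (t : ℝ) :
    ∑ j : Fin m, (if (j : ℕ) < i then t else 0) = i * t := by
  rw [← sum_filter, sum_const, nsmul_eq_mul]
  congr 2
  have := Fin.card_filter_val_lt (n := m) (m := i)
  simpa [hi] using this

theorem lowerSum_jump {i : ℕ} (hi : i ≤ m) (a : Fin m) (x : Fin m → ℝ) :
    lowerSum i (x + Pi.single a (m : ℝ) - 1) =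
      lowerSum i x + (if (a : ℕ) < i then (m : ℝ) else 0) - i := by
  have h1 : (if (a : ℕ) < i then (m : ℝ) else 0)
      = ∑ j : Fin m, if (j : ℕ) < i then (Pi.single a (m : ℝ) : Fin m → ℝ) j else 0 := by
    rw [sum_eq_single a]
    · simp
    · intro b _ hb; simp [hb]
    · simp
  have h2 := sum_ite_lt_const hi 1
  rw [mul_one] at h2
  rw [h1, ← h2, lowerSum, lowerSum, ← sum_add_distrib, ← sum_sub_distrib]
  refine sum_congr rfl fun j _ => ?_
  split_ifs <;> simp

/-- After subtracting the threshold `θ`, the left side becomes `∑ min (y j - θ) 0`, which is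
permutation invariant and a lower bound for the sum over the first `i` places in any order. -/
theorem lowerSum_le_comp_perm {i : ℕ} {y : Fin m → ℝ} {θ : ℝ}
    (hlow : ∀ j : Fin m, (j : ℕ) < i → y j ≤ θ) (hup : ∀ j : Fin m, i ≤ (j : ℕ) → θ ≤ y j)
    (σ : Equiv.Perm (Fin m)) : lowerSum i y ≤ lowerSum i (y ∘ σ) := by
  have h1 : ∀ u : Fin m → ℝ, lowerSum i u =
      ∑ j : Fin m, (if (j : ℕ) < i then u j - θ else 0)
        + ∑ j : Fin m, (if (j : ℕ) < i then θ else 0) := by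
    intro u
    rw [lowerSum, ← sum_add_distrib]
    refine sum_congr rfl fun j _ => ?_
    split_ifs <;> simp
  rw [h1 y, h1 (y ∘ σ)]
  have h2 : ∑ j : Fin m, (if (j : ℕ) < i then y j - θ else 0) = ∑ j, min (y j - θ) 0 := by
    refine sum_congr rfl fun j _ => ?_
    split_ifs with h
    · rw [min_eq_left]; linarith [hlow j h]
    · rw [min_eq_right]; linarith [hup j (not_lt.1 h)]
  have h3 : ∑ j, min (y j - θ) 0 ≤
      ∑ j : Fin m, (if (j : ℕ) < i then (y ∘ σ) j - θ else 0) := by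
    rw [← Equiv.sum_comp σ fun j => min (y j - θ) 0]
    refine sum_le_sum fun j _ => ?_
    split_ifs
    · exact min_le_left _ _
    · exact min_le_right _ _
  linarith

theorem lowerSum_sortTuple_le (i : ℕ) (y : Fin m → ℝ) :
    lowerSum i (sortTuple y) ≤ lowerSum i y := by
  have hy : sortTuple y ∘ (Tuple.sort y).symm = y := by funext j; simp [sortTuple]
  conv_rhs => rw [← hy]
  by_cases hi : i < m
  · refine lowerSum_le_comp_perm (θ := sortTuple y ⟨i, hi⟩) ?_ ?_ _
    · exact fun j hj => monotone_sortTuple y (Fin.mk_le_mk.2 hj.le : j ≤ ⟨i, hi⟩)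
    · exact fun j hj => monotone_sortTuple y (Fin.mk_le_mk.2 hj : ⟨i, hi⟩ ≤ j)
  · refine lowerSum_le_comp_perm (θ := ∑ j, |sortTuple y j|) ?_ ?_ _
    · intro j _
      exact (le_abs_self _).trans
        (single_le_sum (f := fun j => |sortTuple y j|) (fun _ _ => abs_nonneg _) (mem_univ j))
    · intro j hj; exact absurd (hj.trans_lt j.2) hi

theorem lowerSum_letterAct_le {i : ℕ} (hi : i ≤ m) (a : Fin m) (x : Fin m → ℝ) :
    lowerSum i (letterAct a x) ≤ lowerSum i x + (if (a : ℕ) < i then (m : ℝ) else 0) - i :=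
  (lowerSum_sortTuple_le _ _).trans_eq (lowerSum_jump hi a x)

theorem sub_one_le_letterAct (a : Fin m) {x : Fin m → ℝ} (hx : Monotone x) (j : Fin m) :
    x j - 1 ≤ letterAct a x j := by
  have h : sortTuple (x - 1) = x - 1 :=
    sortTuple_eq_self fun i j hij => by simpa using hx hij
  have h2 := sortTuple_mono (x := x - 1) (y := x + Pi.single a (m : ℝ) - 1) (by
    intro k
    have : (0 : ℝ) ≤ (Pi.single a (m : ℝ) : Fin m → ℝ) k := by
      rw [Pi.single_apply]; split_ifs <;> simp
    simp only [Pi.sub_apply, Pi.add_apply, Pi.one_apply]; linarith)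
  rw [h] at h2
  exact h2 j

theorem letterAct_le_add (a : Fin m) {x : Fin m → ℝ} (hx : Monotone x) (j : Fin m) :
    letterAct a x j ≤ x j - 1 + m := by
  have h : sortTuple (fun k => x k - 1 + m) = fun k => x k - 1 + m :=
    sortTuple_eq_self fun i j hij => by simpa using hx hij
  have h2 := sortTuple_mono (x := x + Pi.single a (m : ℝ) - 1) (y := fun k => x k - 1 + m) (by
    intro k
    have : (Pi.single a (m : ℝ) : Fin m → ℝ) k ≤ m := by
      rw [Pi.single_apply]; split_ifs <;> simp
    simp only [Pi.sub_apply, Pi.add_apply, Pi.one_apply]; linarith)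
  rw [h] at h2
  exact h2 j

theorem lowerSum_act_le {i : ℕ} (hi : i ≤ m) (l : List (Fin m)) (x : Fin m → ℝ) :
    lowerSum i (act l x) ≤
      lowerSum i x + m * l.countP (fun a : Fin m => decide ((a : ℕ) < i)) - i * l.length := by
  induction l generalizing x with
  | nil => simp
  | cons a l ih =>
    have h1 := ih (letterAct a x)
    have h2 := lowerSum_letterAct_le hi a x
    rw [act_cons, List.countP_cons, List.length_cons]
    by_cases h : (a : ℕ) < i <;> simp only [h, if_true, if_false, decide_true, decide_false] at h2 ⊢
      <;> push_cast <;> linarith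

theorem sub_le_lowerSum_act {i : ℕ} (hi : i ≤ m) (l : List (Fin m)) {x : Fin m → ℝ}
    (hx : Monotone x) : lowerSum i x - i * l.length ≤ lowerSum i (act l x) := by
  induction l generalizing x with
  | nil => simp
  | cons a l ih =>
    have h1 := ih (x := letterAct a x) (monotone_sortTuple _)
    have h2 : lowerSum i (fun j => x j - 1) ≤ lowerSum i (letterAct a x) :=
      lowerSum_mono i (sub_one_le_letterAct a hx)
    have h3 : lowerSum i (fun j => x j - 1) = lowerSum i x - i := by
      rw [← mul_one (i : ℝ), ← sum_ite_lt_const hi 1, lowerSum, lowerSum, ← sum_sub_distrib]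
      refine sum_congr rfl fun j _ => ?_
      split_ifs <;> simp
    rw [act_cons, List.length_cons]
    push_cast
    linarith

/-- Across a wide enough gap, the letters below `i` act on the first `i` coordinates only. -/
theorem le_lowerSum_act_of_gap {i : ℕ} (hi : i < m) (l : List (Fin m)) {x : Fin m → ℝ}
    (hx : Monotone x) (hgap : ∀ j : Fin m, (j : ℕ) < i → x j + m * l.length ≤ x ⟨i, hi⟩) :
    lowerSum i x + m * l.countP (fun a : Fin m => decide ((a : ℕ) < i)) - i * l.length
      ≤ lowerSum i (act l x) := by
  induction l generalizing x with
  | nil => simp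
  | cons a l ih =>
    rw [List.length_cons] at hgap
    push_cast at hgap
    have hml : (0 : ℝ) ≤ m * l.length := by positivity
    -- A letter moves a sorted coordinate up by at most `m - 1` and down by at most `1`, so each
    -- letter uses up at most `m` of the gap.
    have h1 := ih (x := letterAct a x) (monotone_sortTuple _) (fun j hj => by
      have h1 := hgap j hj
      have h2 := letterAct_le_add a hx j
      have h3 := sub_one_le_letterAct a hx ⟨i, hi⟩
      linarith)
    have h2 : lowerSum i x + (if (a : ℕ) < i then (m : ℝ) else 0) - i
        ≤ lowerSum i (letterAct a x) := by
      rw [← lowerSum_jump hi.le]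
      refine lowerSum_le_comp_perm (θ := x ⟨i, hi⟩ - 1) ?_ ?_ _
      · intro j hj
        have h1 := hgap j hj
        have : (Pi.single a (m : ℝ) : Fin m → ℝ) j ≤ m := by
          rw [Pi.single_apply]; split_ifs <;> simp
        simp only [Pi.sub_apply, Pi.add_apply, Pi.one_apply]; linarith
      · intro j hj
        have h1 : x ⟨i, hi⟩ ≤ x j := hx (Fin.mk_le_mk.2 hj : ⟨i, hi⟩ ≤ j)
        have : (0 : ℝ) ≤ (Pi.single a (m : ℝ) : Fin m → ℝ) j := by
          rw [Pi.single_apply]; split_ifs <;> simp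
        simp only [Pi.sub_apply, Pi.add_apply, Pi.one_apply]; linarith
    rw [act_cons, List.countP_cons, List.length_cons]
    by_cases h : (a : ℕ) < i <;> simp only [h, if_true, if_false, decide_true, decide_false] at h2 ⊢
      <;> push_cast <;> linarith

/-! ### Parking words and fixed points -/

theorem countP_ofFn_eq_card (p : Fin m → Prop) [DecidablePred p] (w : Fin n → Fin m) :
    (List.ofFn w).countP (fun a => decide (p a)) = #{j | p (w j)} := by
  induction n with
  | zero => simp
  | succ n ih =>
    rw [List.ofFn_succ, List.countP_cons, ih, Fin.card_filter_univ_succ]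
    by_cases h : p (w 0) <;> simp [h]

theorem isParkingWord_iff (hm : 1 ≤ m) (w : Fin n → Fin m) :
    IsParkingWord w ↔ ∀ i ≤ m, (i : ℝ) * n ≤
      m * (List.ofFn w).countP (fun a : Fin m => decide ((a : ℕ) < i)) := by
  have hm' : (0 : ℝ) < m := by exact_mod_cast hm
  simp only [IsParkingWord, countP_ofFn_eq_card (fun a : Fin m => (a : ℕ) < _)]
  constructor
  · intro h i hi
    rcases Nat.eq_zero_or_pos i with rfl | h0
    · simp
    · have := h i h0 hi
      rwa [div_le_iff₀ hm', mul_comm _ (m : ℝ)] at this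
  · intro h i _ hi
    rw [div_le_iff₀ hm', mul_comm _ (m : ℝ)]
    exact h i hi

theorem isParkingWord_of_mem_Fix (hm : 1 ≤ m) {w : Fin n → Fin m} {x : Fin m → ℝ}
    (hx : x ∈ Fix w) : IsParkingWord w := by
  rw [isParkingWord_iff hm]
  intro i hi
  have h := lowerSum_act_le hi (List.ofFn w) x
  rw [show act (List.ofFn w) x = x from hx.2, List.length_ofFn] at h
  linarith

/-- The bound has second difference `4nm` in `i`. If the sum at `i` is within `nm` of it, the bounds
at `i ± 1` force a gap above `2nm` just before coordinate `i`, and then parking keeps the sum from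
decreasing. Otherwise there is room for one pass, which costs at most `i n ≤ nm`. -/
theorem act_lowerSum_bound {w : Fin n → Fin m} (hm : 1 ≤ m) (hw : IsParkingWord w)
    {x : Fin m → ℝ} (hx : x ∈ cone m)
    (hK : ∀ i ≤ m, -(2 * n * m * i * (m - i) : ℝ) ≤ lowerSum i x) :
    ∀ i ≤ m, -(2 * n * m * i * (m - i) : ℝ) ≤ lowerSum i (act (List.ofFn w) x) := by
  rw [isParkingWord_iff hm] at hw
  intro i hi
  rcases Nat.eq_zero_or_pos i with rfl | h0
  · simp [lowerSum_zero]
  rcases hi.eq_or_lt with rfl | him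
  · rw [lowerSum_full, (act_mem_cone _ hx).1]; simp
  have hn0 : (0 : ℝ) ≤ n := by positivity
  have him' : (i : ℝ) ≤ m := by exact_mod_cast hi
  have hnm : (0 : ℝ) ≤ n * m := by positivity
  by_cases hbig : -(2 * n * m * i * (m - i) : ℝ) + n * m ≤ lowerSum i x
  · have h1 := sub_le_lowerSum_act hi (List.ofFn w) hx.2
    rw [List.length_ofFn] at h1
    have := mul_le_mul_of_nonneg_right him' hn0
    linarith
  · obtain ⟨k, rfl⟩ : ∃ k, i = k + 1 := ⟨i - 1, by omega⟩
    have hs1 := lowerSum_succ (i := k) (by omega) x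
    have hs2 := lowerSum_succ him x
    have hK1 := hK k (by omega)
    have hK2 := hK (k + 1 + 1) (by omega)
    push_cast at hK1 hK2 hbig
    have hgap := le_lowerSum_act_of_gap him (List.ofFn w) hx.2 (fun j hj => by
      have hj' : x j ≤ x ⟨k, by omega⟩ := hx.2 (Fin.mk_le_mk.2 (by omega) : j ≤ ⟨k, _⟩)
      rw [List.length_ofFn]
      nlinarith)
    rw [List.length_ofFn] at hgap
    have h1 := hw _ hi
    have h2 := hK _ hi
    linarith

theorem exists_mem_Fix {w : Fin n → Fin m} (hm : 1 ≤ m) (hw : IsParkingWord w) :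
    ∃ x, x ∈ Fix w := by
  set T := act (List.ofFn w) with hT
  -- The bounds at `i = 1` and `i = m - 1` both equal `-C`; they confine the smallest and the
  -- largest coordinate.
  set C : ℝ := 2 * n * m * (m - 1) with hC
  obtain ⟨N, hN⟩ := exists_nat_ge C
  have hinv : ∀ k, T^[k] 0 ∈ cone m ∧
      (∀ i ≤ m, -(2 * n * m * i * (m - i) : ℝ) ≤ lowerSum i (T^[k] 0)) ∧
      ∀ j, ∃ z : ℤ, T^[k] 0 j = z := by
    intro k
    induction k with
    | zero =>
      refine ⟨⟨by simp, fun _ _ _ => le_rfl⟩, fun i hi => ?_, fun j => ⟨0, by simp⟩⟩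
      have : (0 : ℝ) ≤ m - i := by rw [sub_nonneg]; exact_mod_cast hi
      have h0 : lowerSum i (0 : Fin m → ℝ) = 0 := by simp [lowerSum]
      rw [Function.iterate_zero, id, h0, neg_nonpos]
      positivity
    | succ k ih =>
      rw [Function.iterate_succ_apply']
      refine ⟨act_mem_cone _ ih.1, act_lowerSum_bound hm hw ih.1 ih.2.1, ?_⟩
      have hint : ∀ (l : List (Fin m)) (x : Fin m → ℝ), (∀ j, ∃ z : ℤ, x j = z) →
          ∀ j, ∃ z : ℤ, act l x j = z := by
        intro l
        induction l with
        | nil => exact fun x hx => hx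
        | cons a l ihl =>
          refine fun x hx => ihl _ fun j => ?_
          obtain ⟨z, hz⟩ := hx (Tuple.sort (x + Pi.single a (m : ℝ) - 1) j)
          refine ⟨z + (Pi.single a (m : ℤ) : Fin m → ℤ)
            (Tuple.sort (x + Pi.single a (m : ℝ) - 1) j) - 1, ?_⟩
          simp only [letterAct, sortTuple, Function.comp_apply, Pi.sub_apply, Pi.add_apply,
            Pi.one_apply, hz, Pi.single_apply]
          push_cast
          rfl
      exact hint _ _ ih.2.2
  have hfin : (Set.range fun f : Fin m → Set.Icc (-(N : ℤ)) N => fun j => ((f j : ℤ) : ℝ)).Finite :=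
    Set.finite_range _
  have hmem : ∀ k, T^[k] 0 ∈
      Set.range fun f : Fin m → Set.Icc (-(N : ℤ)) N => fun j => ((f j : ℤ) : ℝ) := by
    intro k
    obtain ⟨h1, h2, h3⟩ := hinv k
    set u := T^[k] 0
    choose z hz using h3
    have hmr : ((m - 1 : ℕ) : ℝ) = m - 1 := by push_cast [hm]; ring
    have hlow : -C ≤ u ⟨0, hm⟩ := by
      have := h2 1 hm
      rw [lowerSum_succ hm, lowerSum_zero] at this
      push_cast at this
      simp only [hC]; linarith
    have hup : u ⟨m - 1, by omega⟩ ≤ C := by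
      have h4 := h2 (m - 1) (by omega)
      have h5 := lowerSum_succ (i := m - 1) (by omega) u
      rw [show m - 1 + 1 = m by omega, lowerSum_full, h1.1] at h5
      rw [hmr] at h4
      simp only [hC]
      linarith
    refine ⟨fun j => ⟨z j, ?_⟩, funext fun j => (hz j).symm⟩
    have h6 : u ⟨0, hm⟩ ≤ u j := h1.2 (Fin.mk_le_mk.2 (Nat.zero_le _) : ⟨0, hm⟩ ≤ j)
    have h7 : u j ≤ u ⟨m - 1, by omega⟩ := h1.2 (Fin.mk_le_mk.2 (by omega) : j ≤ ⟨m - 1, _⟩)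
    rw [hz j] at h6 h7
    constructor
    · have : (-(N : ℝ)) ≤ z j := by linarith
      exact_mod_cast this
    · have : (z j : ℝ) ≤ N := by linarith
      exact_mod_cast this
  obtain ⟨i, j, hij, heq⟩ := hfin.exists_lt_map_eq_of_forall_mem hmem
  obtain ⟨x, hx, hfix⟩ := exists_fixed_of_periodic (l := List.ofFn w) (hinv i).1
    (Nat.sub_pos_of_lt hij) (by
      rw [← hT, ← Function.iterate_add_apply, Nat.sub_add_cancel hij.le]
      exact heq.symm)
  exact ⟨x, hx, hfix⟩

/-! ### Perturbing the coordinates along a trajectory -/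

theorem add_mul_sub_modEq_iff {p a b t : ℝ} (e f : ℤ) :
    a + p * e - t ≡ b + p * f - t [PMOD p] ↔ a ≡ b [PMOD p] := by
  simp only [AddCommGroup.modEq_iff_zsmul', zsmul_eq_mul]
  constructor
  · rintro ⟨k, hk⟩
    exact ⟨k + e - f, by push_cast; linarith⟩
  · rintro ⟨k, hk⟩
    exact ⟨k - e + f, by push_cast; linarith⟩

theorem letterAct_sortTuple {z : Fin m → ℝ} {σ : Equiv.Perm (Fin m)} (h : Monotone (z ∘ σ))
    (a : Fin m) : letterAct a (sortTuple z) =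
      sortTuple fun i => z i + m * ((Pi.single (σ a) 1 : Fin m → ℤ) i : ℝ) - 1 := by
  rw [sortTuple_eq_comp h, letterAct]
  refine Eq.trans ?_ (sortTuple_comp_perm _ σ)
  congr 1
  funext i
  simp [Pi.single_apply, σ.injective.eq_iff]

/-- The position of a coordinate at `P`, which gives way to no other coordinate at `P`, after the
action of the letters of a list on `x`. -/
noncomputable def track : List (Fin m) → (Fin m → ℝ) → ℝ → ℝ
  | [], _, P => P
  | a :: l, x, P =>
    track l (letterAct a x) (P + (if #{i | x i ≤ P} = (a : ℕ) + 1 then (m : ℝ) else 0) - 1)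

theorem track_modEq (l : List (Fin m)) (x : Fin m → ℝ) (P : ℝ) :
    ∃ k : ℤ, track l x P = P + m * k - l.length := by
  induction l generalizing x P with
  | nil => exact ⟨0, by simp [track]⟩
  | cons a l ih =>
    rw [track]
    obtain ⟨k, hk⟩ := ih (letterAct a x)
      (P + (if #{i | x i ≤ P} = (a : ℕ) + 1 then (m : ℝ) else 0) - 1)
    rw [hk, List.length_cons]
    split_ifs
    · exact ⟨k + 1, by push_cast; ring⟩
    · exact ⟨k, by push_cast; ring⟩

/-- Distinct congruent positions differ by at least `m`, the size of one jump, so the lower one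
cannot overtake. -/
theorem track_le_track (l : List (Fin m)) (x : Fin m → ℝ) {P Q : ℝ} (hPQ : P ≤ Q)
    (hmod : P ≡ Q [PMOD (m : ℝ)]) : track l x P ≤ track l x Q := by
  induction l generalizing x P Q with
  | nil => exact hPQ
  | cons a l ih =>
    have hm0 : (0 : ℝ) ≤ m := by positivity
    rw [track, track]
    apply ih
    · rcases hPQ.eq_or_lt with rfl | hlt
      · exact le_rfl
      · obtain ⟨k, hk⟩ := AddCommGroup.modEq_iff_zsmul'.1 hmod
        rw [zsmul_eq_mul] at hk
        have hk0 : (0 : ℝ) < k * m := by linarith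
        have hk1 : (0 : ℝ) < k := pos_of_mul_pos_left hk0 hm0
        have hk2 : (1 : ℝ) ≤ k := by exact_mod_cast (by exact_mod_cast hk1 : (0 : ℤ) < k)
        have : (m : ℝ) ≤ k * m := le_mul_of_one_le_left hm0 hk2
        split_ifs <;> linarith
    · have h := fun e f : ℤ => (add_mul_sub_modEq_iff (t := 1) e f).2 hmod
      split_ifs
      · simpa using h 1 1
      · simpa using h 1 0
      · simpa using h 0 1
      · simpa using h 0 0

/-- Tuples near `z` whose coordinates that agree modulo `m` are ordered by the key `κ` all make
the same jumps, and a coordinate with strictly maximal key in its class moves along `track`. -/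
theorem exists_jumps (l : List (Fin m)) (z κ : Fin m → ℝ) {F : Filter (Fin m → ℝ)}
    (hF : F ≤ 𝓝 0)
    (hκ : ∀ i j, z i ≡ z j [PMOD (m : ℝ)] → κ i ≤ κ j → ∀ᶠ v in F, v i ≤ v j) :
    ∃ c : Fin m → ℤ,
      act l (sortTuple z) = sortTuple (fun i => z i + m * c i - l.length) ∧
      (∀ᶠ v in F, act l (sortTuple (z + v)) =
        sortTuple fun i => z i + m * c i - l.length + v i) ∧
      ∀ b, (∀ j, j ≠ b → z j ≡ z b [PMOD (m : ℝ)] → κ j < κ b) →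
        z b + m * c b - l.length = track l (sortTuple z) (z b) := by
  induction l generalizing z with
  | nil => exact ⟨0, by simp, by simp [Pi.add_def], by simp [track]⟩
  | cons a l ih =>
    -- With ties in `z` broken by `κ`, the same permutation also sorts `z + v` for `v` eventually
    -- along `F`.
    set σ := Tuple.sort fun i => toLex (z i, κ i) with hσ
    have hlex : ∀ i j, i ≤ j → z (σ i) < z (σ j) ∨ z (σ i) = z (σ j) ∧ κ (σ i) ≤ κ (σ j) := by
      intro i j hij
      have := Tuple.monotone_sort (fun i => toLex (z i, κ i)) hij
      simpa [Prod.Lex.toLex_le_toLex] using this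
    have hz : Monotone (z ∘ σ) := fun i j hij => (hlex i j hij).elim le_of_lt fun h => h.1.le
    have hv : ∀ᶠ v in F, Monotone ((z + v) ∘ σ) := by
      have : ∀ᶠ v in F, ∀ i j, i ≤ j → z (σ i) + v (σ i) ≤ z (σ j) + v (σ j) := by
        refine eventually_all.2 fun i => eventually_all.2 fun j => ?_
        by_cases hij : i ≤ j
        · rcases hlex i j hij with h | ⟨h1, h2⟩
          · have hc : Tendsto (fun v : Fin m → ℝ => v (σ i) - v (σ j)) F (𝓝 0) := by
              have : Continuous fun v : Fin m → ℝ => v (σ i) - v (σ j) := by fun_prop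
              simpa using (this.tendsto 0).mono_left hF
            filter_upwards [hc.eventually (gt_mem_nhds (sub_pos.2 h))] with v hv _
            linarith
          · filter_upwards [hκ _ _ (by rw [h1]) h2] with v hv _
            linarith
        · exact Eventually.of_forall fun _ h => absurd h hij
      filter_upwards [this] with v hv i j hij using hv i j hij
    set e : Fin m → ℤ := Pi.single (σ a) 1 with he
    set z' : Fin m → ℝ := fun i => z i + m * e i - 1 with hz'
    obtain ⟨c, hc1, hc2, hc3⟩ := ih z' fun i j hij => hκ i j ((add_mul_sub_modEq_iff _ _).1 hij)
    refine ⟨fun i => e i + c i, ?_, ?_, ?_⟩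
    · rw [act_cons, letterAct_sortTuple hz, hc1]
      congr 1; funext i
      simp only [hz', List.length_cons]; push_cast; ring
    · filter_upwards [hv, hc2] with v hv1 hv2
      rw [act_cons, letterAct_sortTuple hv1]
      have : (fun i => (z + v) i + m * ((Pi.single (σ a) 1 : Fin m → ℤ) i : ℝ) - 1) = z' + v := by
        funext i; simp only [hz', he, Pi.add_apply]; ring
      rw [this, hv2]
      congr 1; funext i
      simp only [hz', List.length_cons]; push_cast; ring
    · intro b hb
      have h1 := hc3 b fun j hj hjb => hb j hj ((add_mul_sub_modEq_iff _ _).1 hjb)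
      -- Having the strictly largest key, `b` stands last among the coordinates equal to `z b`, as
      -- `track` presumes.
      have hcard : #{i | sortTuple z i ≤ z b} = (σ.symm b : ℕ) + 1 := by
        rw [card_sortTuple_le, ← Fin.card_Iic]
        refine (card_equiv σ fun i => ?_).symm
        rw [mem_Iic, mem_filter]
        constructor
        · intro hi
          refine ⟨mem_univ _, ?_⟩
          simpa using hz hi
        · rintro ⟨-, hi⟩
          by_contra hlt
          rw [not_le] at hlt
          have hne : σ i ≠ b := fun h => by rw [← h] at hlt; simp at hlt
          rcases hlex _ _ hlt.le with h | ⟨h, h'⟩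
          · rw [Equiv.apply_symm_apply] at h; linarith
          · rw [Equiv.apply_symm_apply] at h h'
            exact absurd (hb _ hne (by rw [h])) (not_lt.2 h')
      have hjump : (if #{i | sortTuple z i ≤ z b} = (a : ℕ) + 1 then (m : ℝ) else 0) = m * e b := by
        rw [hcard, he, Pi.single_apply]
        have : (σ.symm b : ℕ) + 1 = (a : ℕ) + 1 ↔ b = σ a := by
          rw [Nat.add_right_cancel_iff, ← Fin.ext_iff, Equiv.symm_apply_eq]
        simp only [this]
        split_ifs <;> simp
      rw [track, letterAct_sortTuple hz, hjump, ← h1]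
      simp only [hz', List.length_cons]; push_cast; ring

theorem iterate_track_modEq (l : List (Fin m)) (x : Fin m → ℝ) (P : ℝ) (j : ℕ) :
    ∃ k : ℤ, (track l x)^[j] P = P + m * k - j * l.length := by
  induction j with
  | zero => exact ⟨0, by simp⟩
  | succ j ih =>
    obtain ⟨k, hk⟩ := ih
    obtain ⟨k', hk'⟩ := track_modEq l x ((track l x)^[j] P)
    rw [Function.iterate_succ_apply', hk', hk]
    exact ⟨k + k', by push_cast; ring⟩

theorem track_mem_range {l : List (Fin m)} {z : Fin m → ℝ}
    (hz : act l (sortTuple z) = sortTuple z) (b : Fin m) :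
    track l (sortTuple z) (z b) ∈ Set.range z := by
  -- Only the tie-breaking in favour of `b` matters here, so the trivial filter `pure 0` suffices.
  obtain ⟨c, hc1, -, hc3⟩ := exists_jumps l z (Pi.single b 1) (F := pure 0) (pure_le_nhds 0)
    (fun i j _ _ => by simp)
  rw [← hc3 b fun j hj _ => by simp [hj]]
  rw [hz] at hc1
  obtain ⟨σ, hσ⟩ := exists_perm_of_sortTuple_eq hc1.symm
  exact ⟨σ b, (congrFun hσ b).symm⟩

/-! ### Fixed points with pairwise incongruent coordinates -/

theorem modEq_iff_div_mem_range {p a b : ℝ} (hp : p ≠ 0) :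
    a ≡ b [PMOD p] ↔ (b - a) / p ∈ Set.range ((↑) : ℤ → ℝ) := by
  rw [AddCommGroup.modEq_iff_zsmul']
  refine exists_congr fun k => ?_
  rw [zsmul_eq_mul, eq_div_iff hp, eq_comm]

theorem eventually_not_modEq {p : ℝ} (hp : p ≠ 0) {f g : ℝ → ℝ} (hf : Continuous f)
    (hg : Continuous g) {t : ℝ} (h : ¬ f t ≡ g t [PMOD p]) :
    ∀ᶠ s in 𝓝 t, ¬ f s ≡ g s [PMOD p] := by
  simp only [modEq_iff_div_mem_range hp] at h ⊢
  have hc : Continuous fun s => (g s - f s) / p := (hg.sub hf).div_const p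
  exact hc.continuousAt.eventually_mem
    (Int.isClosedEmbedding_coe_real.isClosed_range.isOpen_compl.mem_nhds h)

/-- The least `P` with `f P ≤ P` is fixed, since `f P` has the same property. -/
theorem exists_fixed_of_mapsTo_of_monotoneOn {S : Finset ℝ} (hS : S.Nonempty) {f : ℝ → ℝ}
    (hf : ∀ P ∈ S, f P ∈ S) (hmono : ∀ P ∈ S, ∀ Q ∈ S, P ≤ Q → f P ≤ f Q) :
    ∃ P ∈ S, f P = P := by
  have hne : (S.filter fun P => f P ≤ P).Nonempty :=
    ⟨S.max' hS, mem_filter.2 ⟨S.max'_mem hS, S.le_max' _ (hf _ (S.max'_mem hS))⟩⟩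
  obtain ⟨hP, hle⟩ := mem_filter.1 (min'_mem _ hne)
  refine ⟨_, hP, le_antisymm hle (min'_le _ _ (mem_filter.2 ⟨hf _ hP, ?_⟩))⟩
  exact hmono _ (hf _ hP) _ hP hle

theorem iterate_track_le (l : List (Fin m)) (x : Fin m → ℝ) {P Q : ℝ} (hPQ : P ≤ Q)
    (hmod : P ≡ Q [PMOD (m : ℝ)]) (j : ℕ) : (track l x)^[j] P ≤ (track l x)^[j] Q := by
  induction j with
  | zero => exact hPQ
  | succ j ih =>
    rw [Function.iterate_succ_apply', Function.iterate_succ_apply']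
    refine track_le_track l x ih ?_
    obtain ⟨k, hk⟩ := iterate_track_modEq l x P j
    obtain ⟨k', hk'⟩ := iterate_track_modEq l x Q j
    rw [hk, hk']
    exact (add_mul_sub_modEq_iff k k').2 hmod

/-- The residues `P - i n` along a trajectory repeat only with period `m / gcd`. -/
theorem modEq_of_mul_modEq (hm : 0 < m) {P : ℝ} {k k' : ℤ} {i j : ℕ}
    (h : P + m * k - i * n ≡ P + m * k' - j * n [PMOD (m : ℝ)]) :
    i ≡ j [MOD m / m.gcd n] := by
  apply Nat.ModEq.cancel_right_div_gcd hm
  obtain ⟨t, ht⟩ := AddCommGroup.modEq_iff_zsmul'.1 h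
  rw [zsmul_eq_mul] at ht
  apply Nat.ModEq.symm
  rw [Nat.modEq_iff_dvd]
  refine ⟨t + k - k', ?_⟩
  have : (i : ℝ) * n - j * n = m * (t + k - k') := by linarith
  push_cast
  exact_mod_cast this

theorem add_mul_sub_div_gcd_mul_modEq (P : ℝ) (k : ℤ) :
    P + m * k - ((m / m.gcd n : ℕ) : ℝ) * n ≡ P [PMOD (m : ℝ)] := by
  have h1 : m / m.gcd n * n = m * (n / m.gcd n) := by
    rw [← Nat.mul_div_assoc _ (Nat.gcd_dvd_right _ _),
      Nat.div_mul_right_comm (Nat.gcd_dvd_left _ _)]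
  have h2 : ((m / m.gcd n : ℕ) : ℝ) * n = m * ((n / m.gcd n : ℕ) : ℝ) := by exact_mod_cast h1
  refine AddCommGroup.modEq_iff_zsmul'.2 ⟨(n / m.gcd n : ℕ) - k, ?_⟩
  rw [h2, zsmul_eq_mul, Int.cast_sub, Int.cast_natCast]
  ring

/-- After `m / gcd` passes `track` is back in its residue class; on the entries of `z` in that class
it is a monotone self-map of a finite set, hence fixes one. -/
theorem exists_track_cycle {l : List (Fin m)} {z : Fin m → ℝ}
    (hz : act l (sortTuple z) = sortTuple z) (a : Fin m) :
    ∃ P, P ≡ z a [PMOD (m : ℝ)] ∧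
      (track l (sortTuple z))^[m / m.gcd l.length] P = P ∧
      ∀ j, (track l (sortTuple z))^[j] P ∈ Set.range z := by
  classical
  set T := track l (sortTuple z)
  have hrange : ∀ P ∈ Set.range z, ∀ j, T^[j] P ∈ Set.range z := by
    intro P hP j
    induction j with
    | zero => exact hP
    | succ j ih =>
      rw [Function.iterate_succ_apply']
      obtain ⟨b, hb⟩ := ih
      rw [← hb]
      exact track_mem_range hz b
  have hS : ∀ {P}, P ∈ (univ.image z).filter (fun P => P ≡ z a [PMOD (m : ℝ)]) ↔
      P ∈ Set.range z ∧ P ≡ z a [PMOD (m : ℝ)] := by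
    intro P; simp
  obtain ⟨P, hP, hfix⟩ := exists_fixed_of_mapsTo_of_monotoneOn
    (S := (univ.image z).filter (fun P => P ≡ z a [PMOD (m : ℝ)]))
    (f := T^[m / m.gcd l.length]) ⟨z a, hS.2 ⟨⟨a, rfl⟩, AddCommGroup.modEq_rfl⟩⟩ (by
      intro P hP
      rw [hS] at hP ⊢
      refine ⟨hrange P hP.1 _, ?_⟩
      obtain ⟨k, hk⟩ := iterate_track_modEq l (sortTuple z) P (m / m.gcd l.length)
      rw [hk]
      exact (add_mul_sub_div_gcd_mul_modEq P k).trans hP.2) (by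
      intro P hP Q hQ hle
      rw [hS] at hP hQ
      exact iterate_track_le l _ hle (hP.2.trans hQ.2.symm) _)
  rw [hS] at hP
  exact ⟨P, hP.2, hfix, hrange P hP.1⟩

open Classical in
/-- Two congruent coordinates of a fixed point can be separated by a small perturbation that
creates no new congruences. -/
theorem exists_fixed_fewer_congruences {l : List (Fin m)} (hm : 0 < m) {z : Fin m → ℝ}
    (hz : act l (sortTuple z) = sortTuple z) {a b : Fin m} (hab : a ≠ b)
    (hmod : z a ≡ z b [PMOD (m : ℝ)]) :
    ∃ z' : Fin m → ℝ, act l (sortTuple z') = sortTuple z' ∧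
      #{p : Fin m × Fin m | z' p.1 ≡ z' p.2 [PMOD (m : ℝ)]}
        < #{p : Fin m × Fin m | z p.1 ≡ z p.2 [PMOD (m : ℝ)]} := by
  have hm' : (0 : ℝ) < m := by exact_mod_cast hm
  set T := track l (sortTuple z) with hT
  obtain ⟨P, hPa, hcyc, hrange⟩ := exists_track_cycle hz a
  set L := m / m.gcd l.length with hL
  have hL0 : 0 < L := Nat.div_pos (Nat.gcd_le_left _ hm) (Nat.gcd_pos_of_pos_left _ hm)
  choose β hβ using hrange
  have hsep : ∀ s < L, ∀ t < L, z (β s) ≡ z (β t) [PMOD (m : ℝ)] → s = t := by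
    intro s hs t ht h
    obtain ⟨k, hk⟩ := iterate_track_modEq l (sortTuple z) P s
    obtain ⟨k', hk'⟩ := iterate_track_modEq l (sortTuple z) P t
    rw [hβ, hβ, hk, hk'] at h
    exact (modEq_of_mul_modEq hm h).eq_of_lt_of_lt hs ht
  -- One coordinate for each position on the cycle. These are pairwise incongruent, so the key `1`
  -- on `B` is strictly maximal within each class that `B` meets.
  set B : Finset (Fin m) := (range L).image β with hB
  have hBinj : ∀ i ∈ B, ∀ j ∈ B, z i ≡ z j [PMOD (m : ℝ)] → i = j := by
    intro i hi j hj h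
    obtain ⟨s, hs, rfl⟩ := mem_image.1 hi
    obtain ⟨t, ht, rfl⟩ := mem_image.1 hj
    rw [hsep s (mem_range.1 hs) t (mem_range.1 ht) h]
  have hsumB : ∀ h : Fin m → ℤ, ∑ i ∈ B, h i = ∑ s ∈ range L, h (β s) := fun h =>
    sum_image fun s hs t ht hst =>
      hsep s (mem_range.1 hs) t (mem_range.1 ht) (by rw [hst])
  set κ : Fin m → ℝ := fun i => if i ∈ B then 1 else 0 with hκ
  obtain ⟨c, hc1, hc2, hc3⟩ := exists_jumps l z κ
    (F := map (fun ε : ℝ => ε • κ) (𝓝[≥] 0)) (by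
      have : Continuous fun ε : ℝ => ε • κ := by fun_prop
      have h := this.tendsto 0
      rw [zero_smul] at h
      exact h.mono_left nhdsWithin_le_nhds) (by
      intro i j _ hij
      rw [eventually_map]
      filter_upwards [self_mem_nhdsWithin] with ε hε
      exact mul_le_mul_of_nonneg_left hij hε)
  rw [eventually_map] at hc2
  set z₁ : Fin m → ℝ := fun i => z i + m * c i - l.length with hz₁
  obtain ⟨σ, hσ⟩ := exists_perm_of_sortTuple_eq (x := z₁) (y := z) (by rw [← hc1, hz])
  have htag : ∀ s < L, z₁ (β s) = T^[s + 1] P := by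
    intro s hs
    have hmem : β s ∈ B := mem_image_of_mem β (mem_range.2 hs)
    have := hc3 (β s) (by
      intro j hj hjs
      have : j ∉ B := fun h => hj (hBinj j h _ hmem hjs)
      simp [hκ, this, hmem])
    rw [Function.iterate_succ_apply', ← hβ s]
    exact this
  -- A pass advances the closed cycle by one step, so `B` occupies the same positions before and
  -- after.
  have hshift : ∀ h : ℝ → ℤ, ∑ i ∈ B, h (z₁ i) = ∑ i ∈ B, h (z i) := by
    intro h
    have h3 : ∑ s ∈ range L, h (z₁ (β s)) = ∑ s ∈ range L, h (T^[s + 1] P) :=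
      sum_congr rfl fun s hs => by rw [htag s (mem_range.1 hs)]
    have h4 : ∑ s ∈ range L, h (z (β s)) = ∑ s ∈ range L, h (T^[s] P) :=
      sum_congr rfl fun s _ => by rw [hβ s]
    rw [hsumB fun i => h (z₁ i), hsumB fun i => h (z i), h3, h4]
    have h1 := sum_range_succ (fun s => h (T^[s] P)) L
    have h2 := sum_range_succ' (fun s => h (T^[s] P)) L
    rw [hcyc] at h1
    simp only [Function.iterate_zero, id] at h2
    linarith
  -- The entries of `z₁` and `z` agree as multisets, both overall and on `B`, hence still agree
  -- after `B` is raised by `ε`.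
  have hsort : ∀ ε : ℝ, sortTuple (fun i => z₁ i + ε * κ i) = sortTuple fun i => z i + ε * κ i := by
    intro ε
    have hsplit : ∀ (u : Fin m → ℝ) (g : ℝ → ℤ), ∑ i, g (u i + ε * κ i)
        = ∑ i, g (u i) + ∑ i ∈ B, (g (u i + ε) - g (u i)) := by
      intro u g
      have hB' : ∑ i ∈ B, (g (u i + ε) - g (u i))
          = ∑ i, if i ∈ B then g (u i + ε) - g (u i) else 0 := by simp
      rw [hB', ← sum_add_distrib]
      refine sum_congr rfl fun i _ => ?_
      by_cases hi : i ∈ B <;> simp [hκ, hi]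
    refine sortTuple_congr fun t => ?_
    have hg : ∑ i, (if z₁ i + ε * κ i ≤ t then (1 : ℤ) else 0)
        = ∑ i, if z i + ε * κ i ≤ t then (1 : ℤ) else 0 := by
      have h1 := hsplit z₁ fun y => if y ≤ t then 1 else 0
      have h2 := hsplit z fun y => if y ≤ t then 1 else 0
      have h3 := hshift fun y => (if y + ε ≤ t then 1 else 0) - if y ≤ t then 1 else 0
      have h4 : ∑ i, (if z₁ i ≤ t then (1 : ℤ) else 0) = ∑ i, if z i ≤ t then (1 : ℤ) else 0 := by
        rw [hσ]
        exact Equiv.sum_comp σ fun i => if z i ≤ t then (1 : ℤ) else 0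
      rw [h1, h2, h3, h4]
    rw [← natCast_card_filter, ← natCast_card_filter] at hg
    exact_mod_cast hg
  have hev : ∀ᶠ ε : ℝ in 𝓝[>] 0, act l (sortTuple (z + ε • κ)) = sortTuple (z + ε • κ) ∧ ε < m ∧
      0 < ε ∧ ∀ i j, ¬ z i ≡ z j [PMOD (m : ℝ)] →
        ¬ z i + ε * κ i ≡ z j + ε * κ j [PMOD (m : ℝ)] := by
    have h1 := hc2.filter_mono (nhdsWithin_mono 0 Set.Ioi_subset_Ici_self)
    have h2 : ∀ᶠ ε : ℝ in 𝓝[>] 0, ε < m := nhdsWithin_le_nhds (gt_mem_nhds hm')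
    have h3 : ∀ᶠ ε : ℝ in 𝓝 0, ∀ i j, ¬ z i ≡ z j [PMOD (m : ℝ)] →
        ¬ z i + ε * κ i ≡ z j + ε * κ j [PMOD (m : ℝ)] := by
      refine eventually_all.2 fun i => eventually_all.2 fun j => ?_
      by_cases hij : z i ≡ z j [PMOD (m : ℝ)]
      · exact Eventually.of_forall fun _ h => absurd hij h
      · filter_upwards [eventually_not_modEq hm'.ne' (f := fun ε => z i + ε * κ i)
          (g := fun ε => z j + ε * κ j) (t := 0) (by fun_prop) (by fun_prop) (by simpa using hij)]
          with ε hε _ using hε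
    filter_upwards [h1, h2, self_mem_nhdsWithin, nhdsWithin_le_nhds h3] with ε e1 e2 e3 e4
    exact ⟨e1.trans (hsort ε), e2, e3, e4⟩
  obtain ⟨ε, hfix, hεm, hε0, hε⟩ := hev.exists
  refine ⟨z + ε • κ, hfix, card_lt_card ?_⟩
  rw [ssubset_iff_of_subset]
  -- At most one of `a`, `b` lies in `B`, and both are congruent to `P`; one outside `B` is left
  -- behind by `β 0`.
  · obtain ⟨e, heB, he⟩ : ∃ e, e ∉ B ∧ P ≡ z e [PMOD (m : ℝ)] := by
      by_cases haB : a ∈ B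
      · exact ⟨b, fun hbB => hab (hBinj a haB b hbB hmod), hPa.trans hmod⟩
      · exact ⟨a, haB, hPa⟩
    have h0 : β 0 ∈ B := mem_image_of_mem β (mem_range.2 hL0)
    have hβ0 : z (β 0) = P := hβ 0
    refine ⟨(β 0, e), by simpa [hβ0] using he, ?_⟩
    simp only [mem_filter, mem_univ, true_and, Pi.add_apply, Pi.smul_apply, smul_eq_mul, hκ, h0,
      heB, if_true, if_false, hβ0]
    intro h
    obtain ⟨k, hk⟩ := AddCommGroup.modEq_iff_zsmul'.1 h
    obtain ⟨k', hk'⟩ := AddCommGroup.modEq_iff_zsmul'.1 he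
    rw [zsmul_eq_mul] at hk hk'
    have h1 : ε = ((k' - k : ℤ) : ℝ) * m := by push_cast; linarith
    have h2 : (0 : ℝ) < ((k' - k : ℤ) : ℝ) := pos_of_mul_pos_left (h1 ▸ hε0) hm'.le
    have h3 : (1 : ℝ) ≤ ((k' - k : ℤ) : ℝ) := by
      exact_mod_cast (by exact_mod_cast h2 : (0 : ℤ) < k' - k)
    have := le_mul_of_one_le_left hm'.le h3
    linarith
  · refine monotone_filter_right _ fun p _ hp => ?_
    by_contra hn
    exact hε _ _ hn hp

theorem exists_fixed_incongruent {l : List (Fin m)} (hm : 0 < m) {x : Fin m → ℝ}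
    (hx : act l (sortTuple x) = sortTuple x) :
    ∃ z : Fin m → ℝ, act l (sortTuple z) = sortTuple z ∧
      ∀ i j, z i ≡ z j [PMOD (m : ℝ)] → i = j := by
  classical
  induction hN : #{p : Fin m × Fin m | x p.1 ≡ x p.2 [PMOD (m : ℝ)]}
    using Nat.strong_induction_on generalizing x with
  | _ N ih =>
    by_cases h : ∀ i j, x i ≡ x j [PMOD (m : ℝ)] → i = j
    · exact ⟨x, hx, h⟩
    · push Not at h
      obtain ⟨i, j, hmod, hij⟩ := h
      obtain ⟨z, hz, hlt⟩ := exists_fixed_fewer_congruences hm hx hij hmod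
      exact ih _ (hN ▸ hlt) hz rfl

/-! ### Dimension of the set of fixed points -/

theorem pow_perm_apply {x : Fin m → ℝ} {σ : Equiv.Perm (Fin m)} {c : Fin m → ℤ}
    (hσ : ∀ i, x (σ i) = x i + m * c i - n) (j : ℕ) (i : Fin m) :
    ∃ k : ℤ, x ((σ ^ j) i) = x i + m * k - j * n := by
  induction j with
  | zero => exact ⟨0, by simp⟩
  | succ j ih =>
    obtain ⟨k, hk⟩ := ih
    refine ⟨k + c ((σ ^ j) i), ?_⟩
    rw [pow_succ', Equiv.Perm.mul_apply, hσ, hk]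
    push_cast; ring

/-- Incongruence makes every power of `σ` with a fixed point trivial, and the order of `σ` is `m /
gcd`. Burnside's formula then counts the orbits of this free action. -/
theorem card_orbits_eq_gcd (hm : 0 < m) {x : Fin m → ℝ} {σ : Equiv.Perm (Fin m)}
    {c : Fin m → ℤ} (hx : ∀ i j, x i ≡ x j [PMOD (m : ℝ)] → i = j)
    (hσ : ∀ i, x (σ i) = x i + m * c i - n) :
    Nat.card (MulAction.orbitRel.Quotient (Subgroup.zpowers σ) (Fin m)) = m.gcd n := by
  classical
  set L := m / m.gcd n with hL
  have hL0 : 0 < L := Nat.div_pos (Nat.gcd_le_left _ hm) (Nat.gcd_pos_of_pos_left _ hm)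
  have hpow : σ ^ L = 1 := by
    ext1 i
    obtain ⟨k, hk⟩ := pow_perm_apply hσ L i
    exact hx _ _ (by rw [hk]; exact add_mul_sub_div_gcd_mul_modEq (x i) k)
  have hfree : ∀ j i, (σ ^ j) i = i → L ∣ j := by
    intro j i hji
    obtain ⟨k, hk⟩ := pow_perm_apply hσ j i
    rw [hji] at hk
    refine (Nat.modEq_zero_iff_dvd).1 (modEq_of_mul_modEq (n := n) (P := x i) (k := k) (k' := 0)
      hm ?_)
    rw [← hk]
    simp
  have hord : orderOf σ = L := by
    apply Nat.dvd_antisymm (orderOf_dvd_of_pow_eq_one hpow)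
    exact hfree _ ⟨0, hm⟩ (by rw [pow_orderOf_eq_one]; rfl)
  have hfix : ∀ g : Subgroup.zpowers σ,
      Fintype.card (MulAction.fixedBy (Fin m) g) = if g = 1 then m else 0 := by
    intro g
    split_ifs with hg
    · subst hg
      rw [Fintype.card_congr (Equiv.subtypeUnivEquiv fun i => ?_), Fintype.card_fin]
      simp
    · rw [Fintype.card_eq_zero_iff]
      refine ⟨fun ⟨i, hi⟩ => hg ?_⟩
      obtain ⟨j, hj⟩ := (mem_powers_iff_mem_zpowers (x := σ)).2 g.2
      have hj' : σ ^ j = (g : Equiv.Perm (Fin m)) := hj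
      have hi' : (σ ^ j) i = i := by rw [hj']; exact hi
      obtain ⟨q, hq⟩ := hfree j i hi'
      ext1
      rw [← hj', hq, pow_mul, hpow, one_pow]
      rfl
  have hburn := MulAction.sum_card_fixedBy_eq_card_orbits_mul_card_group
    (Subgroup.zpowers σ) (Fin m)
  rw [Fintype.card_zpowers, hord] at hburn
  simp only [hfix, sum_ite_eq', mem_univ, if_true] at hburn
  rw [Nat.card_eq_fintype_card]
  apply Nat.eq_of_mul_eq_mul_right hL0
  rw [hL, Nat.mul_div_cancel' (Nat.gcd_dvd_left _ _), ← hL]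
  exact hburn.symm

/-- The sum-zero vectors invariant under a permutation of the coordinates. -/
def invariantSumZero (σ : Equiv.Perm (Fin m)) : Submodule ℝ (Fin m → ℝ) where
  carrier := {v | (∀ i, v (σ i) = v i) ∧ ∑ i, v i = 0}
  add_mem' := fun {u v} hu hv =>
    ⟨fun i => by simp [hu.1, hv.1], by simp [sum_add_distrib, hu.2, hv.2]⟩
  zero_mem' := by simp
  smul_mem' := fun t v hv => ⟨fun i => by simp [hv.1], by simp [← mul_sum, hv.2]⟩

/-- Invariant vectors are functions on the orbits; the coordinate sum is a nonzero functional on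
them, with value `m` at the constant `1`, so its kernel loses one dimension. -/
theorem finrank_invariantSumZero (hm : 0 < m) (σ : Equiv.Perm (Fin m)) :
    Module.finrank ℝ (invariantSumZero σ) =
      Nat.card (MulAction.orbitRel.Quotient (Subgroup.zpowers σ) (Fin m)) - 1 := by
  classical
  set Q := MulAction.orbitRel.Quotient (Subgroup.zpowers σ) (Fin m)
  let π : Fin m → Q := Quotient.mk _
  have hπ : Function.Surjective π := Quotient.mk_surjective
  let Φ : (Q → ℝ) →ₗ[ℝ] (Fin m → ℝ) := LinearMap.funLeft ℝ ℝ π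
  have hΦ : Function.Injective Φ := LinearMap.funLeft_injective_of_surjective ℝ ℝ π hπ
  let S : (Fin m → ℝ) →ₗ[ℝ] ℝ := ∑ i, LinearMap.proj i
  have hS : ∀ v, S v = ∑ i, v i := fun v => by simp [S]
  have hmap : invariantSumZero σ = (LinearMap.ker (S ∘ₗ Φ)).map Φ := by
    ext v
    rw [Submodule.mem_map]
    constructor
    · rintro ⟨hv, hsum⟩
      have hzpow : ∀ (k : ℤ) i, v ((σ ^ k) i) = v i := by
        intro k
        induction k using Int.induction_on with
        | zero => simp
        | succ k ih => intro i; rw [zpow_add_one, Equiv.Perm.mul_apply, ih, hv]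
        | pred k ih =>
          intro i
          rw [zpow_sub_one, Equiv.Perm.mul_apply, ih, ← hv (σ⁻¹ i), ← Equiv.Perm.mul_apply,
            mul_inv_cancel, Equiv.Perm.one_apply]
      have hlift : Φ (Quotient.lift v (by
          rintro i j ⟨⟨g, k, rfl⟩, rfl⟩
          exact hzpow k j)) = v := rfl
      refine ⟨_, ?_, hlift⟩
      rw [LinearMap.mem_ker, LinearMap.comp_apply, hlift, hS, hsum]
    · rintro ⟨u, hu, rfl⟩
      rw [LinearMap.mem_ker, LinearMap.comp_apply, hS] at hu
      refine ⟨fun i => ?_, hu⟩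
      have : π (σ i) = π i := Quotient.sound ⟨⟨σ, Subgroup.mem_zpowers σ⟩, rfl⟩
      exact congrArg u this
  have hne : S ∘ₗ Φ ≠ 0 := by
    intro h
    have h1 := LinearMap.congr_fun h 1
    rw [LinearMap.comp_apply, hS] at h1
    have h2 : ∀ i, Φ 1 i = 1 := fun _ => rfl
    simp only [h2, sum_const, card_univ, Fintype.card_fin, nsmul_eq_mul, mul_one,
      LinearMap.zero_apply, Nat.cast_eq_zero] at h1
    omega
  have hker := Module.Dual.finrank_ker_add_one_of_ne_zero (f := S ∘ₗ Φ) hne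
  rw [Module.finrank_fintype_fun_eq_card, ← Nat.card_eq_fintype_card] at hker
  rw [hmap, (Submodule.equivMapOfInjective Φ hΦ _).finrank_eq.symm]
  omega

theorem eventually_monotone_add {x : Fin m → ℝ} (hx : StrictMono x) :
    ∀ᶠ v : Fin m → ℝ in 𝓝 0, Monotone (x + v) := by
  have : ∀ᶠ v : Fin m → ℝ in 𝓝 0, ∀ i j, i ≤ j → x i + v i ≤ x j + v j := by
    refine eventually_all.2 fun i => eventually_all.2 fun j => ?_
    by_cases hij : i < j
    · have hc : Continuous fun v : Fin m → ℝ => v i - v j := by fun_prop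
      have ht := hc.tendsto 0
      simp only [Pi.zero_apply, sub_zero] at ht
      filter_upwards [ht.eventually (gt_mem_nhds (sub_pos.2 (hx hij)))] with v hv _
      linarith
    · refine Eventually.of_forall fun v h => ?_
      rw [le_antisymm h (not_lt.1 hij)]
  filter_upwards [this] with v hv i j hij using hv i j hij

/-- Near a fixed point with pairwise incongruent coordinates, the action permutes the
coordinates of the displacement. -/
theorem exists_perm_act_add {l : List (Fin m)} {x : Fin m → ℝ} (hmono : Monotone x)
    (hfix : act l x = x) (hx : ∀ i j, x i ≡ x j [PMOD (m : ℝ)] → i = j) :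
    ∃ (σ : Equiv.Perm (Fin m)) (c : Fin m → ℤ), (∀ i, x (σ i) = x i + m * c i - l.length) ∧
      ∀ᶠ v : Fin m → ℝ in 𝓝 0, Monotone (x + v) ∧ act l (x + v) = x + v ∘ σ.symm := by
  have hstrict : StrictMono x :=
    hmono.strictMono_of_injective fun i j hij => hx i j (by rw [hij])
  obtain ⟨c, hc1, hc2, -⟩ := exists_jumps l x 0 le_rfl fun i j hij _ =>
    Eventually.of_forall fun v => by rw [hx i j hij]
  rw [sortTuple_eq_self hmono, hfix] at hc1
  obtain ⟨σ, hσ⟩ := exists_perm_of_sortTuple_eq (y := x)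
    (hc1.symm.trans (sortTuple_eq_self hmono).symm)
  have hσ' : ∀ i, x (σ i) = x i + m * c i - l.length := fun i => (congrFun hσ i).symm
  refine ⟨σ, c, hσ', ?_⟩
  have hcont : Tendsto (fun v : Fin m → ℝ => v ∘ σ.symm) (𝓝 0) (𝓝 0) := by
    have : Continuous fun v : Fin m → ℝ => v ∘ σ.symm := by fun_prop
    exact this.tendsto 0
  filter_upwards [hc2, eventually_monotone_add hstrict,
    hcont.eventually (eventually_monotone_add hstrict)] with v h1 h2 h3
  refine ⟨h2, ?_⟩
  rw [sortTuple_eq_self h2] at h1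
  rw [h1, ← sortTuple_eq_self h3, ← sortTuple_comp_perm (x + v ∘ σ.symm) σ]
  congr 1
  funext i
  simp [hσ']

theorem exists_mem_Fix_incongruent {w : Fin n → Fin m} (hm : 1 ≤ m) (hw : IsParkingWord w) :
    ∃ x ∈ Fix w, ∀ i j, x i ≡ x j [PMOD (m : ℝ)] → i = j := by
  have hm' : (m : ℝ) ≠ 0 := by exact_mod_cast (by omega : m ≠ 0)
  obtain ⟨y, hy, hfix⟩ := exists_mem_Fix hm hw
  rw [wordAct_eq_act] at hfix
  obtain ⟨z, hz, hinc⟩ := exists_fixed_incongruent hm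
    (by rwa [sortTuple_eq_self hy.2] : act (List.ofFn w) (sortTuple y) = sortTuple y)
  -- Separating congruences may spoil the zero sum; translation restores it and commutes with the
  -- action.
  set t := -(∑ i, z i) / m with ht
  refine ⟨fun i => sortTuple z i + t, ⟨⟨?_, ?_⟩, ?_⟩, ?_⟩
  · rw [sum_add_distrib, sum_sortTuple, sum_const, card_univ, Fintype.card_fin, nsmul_eq_mul, ht]
    field_simp
    ring
  · exact fun i j hij => by simpa using monotone_sortTuple z hij
  · rw [wordAct_eq_act, act_add_const, hz]
  · intro i j hij
    exact (Tuple.sort z).injective (hinc _ _ (hij.add_right_cancel' t))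

theorem hasAffineDim_Fix {w : Fin n → Fin m} (hm : 1 ≤ m) (hw : IsParkingWord w) :
    HasAffineDim (Fix w) (m.gcd n - 1) := by
  obtain ⟨x, hx, hinc⟩ := exists_mem_Fix_incongruent hm hw
  obtain ⟨σ, c, hσ, hev⟩ := exists_perm_act_add hx.1.2 hx.2 hinc
  rw [List.length_ofFn] at hσ
  refine ⟨convex_Fix w, AffineSubspace.mk' x (invariantSumZero σ), ?_, ?_, x,
    AffineSubspace.self_mem_mk' _ _, ?_⟩
  · rw [AffineSubspace.direction_mk', finrank_invariantSumZero hm,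
      card_orbits_eq_gcd hm hinc hσ]
  · intro y hy
    rw [SetLike.mem_coe, AffineSubspace.mem_mk', vsub_eq_sub]
    refine ⟨fun i => ?_, by simp [sum_sub_distrib, hx.1.1, hy.1.1]⟩
    -- By convexity the segment from `x` to `y` is fixed; its points near `x` fall under the local
    -- description, which forces `y - x` to be invariant.
    have hcont : Tendsto (fun t : ℝ => t • (y - x)) (𝓝[>] 0) (𝓝 0) := by
      have : Continuous fun t : ℝ => t • (y - x) := by fun_prop
      have h := this.tendsto 0
      rw [zero_smul] at h
      exact h.mono_left nhdsWithin_le_nhds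
    have hlt : ∀ᶠ t : ℝ in 𝓝[>] 0, t < 1 := nhdsWithin_le_nhds (gt_mem_nhds one_pos)
    obtain ⟨t, ⟨-, ht⟩, ht1, ht0⟩ :=
      ((hcont.eventually hev).and (hlt.and self_mem_nhdsWithin)).exists
    have ht0' : (0 : ℝ) < t := ht0
    have hcomb : x + t • (y - x) = (1 - t) • x + t • y := by
      rw [smul_sub, sub_smul, one_smul]; abel
    have hfix : act (List.ofFn w) (x + t • (y - x)) = x + t • (y - x) := by
      rw [hcomb]
      exact act_convex_combination hx.2 hy.2 (by linarith) ht0'.le (by ring)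
    rw [hfix, add_right_inj] at ht
    have h1 := congrFun ht (σ i)
    simp only [Pi.smul_apply, Function.comp_apply, Equiv.symm_apply_apply, smul_eq_mul] at h1
    exact mul_left_cancel₀ ht0'.ne' h1
  · obtain ⟨r, hr, hball⟩ := Metric.eventually_nhds_iff.1 hev
    refine ⟨r, hr, fun y hy hdist => ?_⟩
    rw [AffineSubspace.mem_mk', vsub_eq_sub] at hy
    obtain ⟨h1, h2⟩ := hball (y := y - x) (by
      rw [dist_pi_lt_iff hr]
      intro i
      rw [Pi.zero_apply, Real.dist_eq, sub_zero, Pi.sub_apply]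
      refine abs_lt_of_sq_lt_sq (lt_of_le_of_lt ?_ hdist) hr.le
      exact single_le_sum (f := fun i => (y i - x i) ^ 2) (fun _ _ => sq_nonneg _) (mem_univ i))
    have hinv : (y - x) ∘ σ.symm = y - x := by
      funext i
      rw [Function.comp_apply, ← hy.1 (σ.symm i), Equiv.apply_symm_apply]
    rw [hinv, add_sub_cancel] at h2
    rw [add_sub_cancel] at h1
    refine ⟨⟨?_, h1⟩, h2⟩
    have := hy.2
    simp only [Pi.sub_apply, sum_sub_distrib, hx.1.1, sub_zero] at this
    exact this

/-! ### From affine dimension to the number of fixed points -/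

theorem HasAffineDim.subsingleton {X : Set (Fin m → ℝ)} (h : HasAffineDim X 0) :
    X.Subsingleton := by
  obtain ⟨-, A, hdim, hX, -⟩ := h
  intro x hx y hy
  have hmem := AffineSubspace.vsub_mem_direction (hX hx) (hX hy)
  rw [Submodule.finrank_eq_zero.1 hdim, Submodule.mem_bot] at hmem
  exact vsub_eq_zero_iff_eq.1 hmem

theorem HasAffineDim.infinite {X : Set (Fin m → ℝ)} {k : ℕ} (h : HasAffineDim X k)
    (hk : 0 < k) : X.Infinite := by
  obtain ⟨-, A, hdim, -, c, hc, r, hr, hball⟩ := h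
  have hne : A.direction ≠ ⊥ := by
    intro h0
    rw [h0, finrank_bot] at hdim
    omega
  obtain ⟨v, hv, hv0⟩ := Submodule.exists_mem_ne_zero_of_ne_bot hne
  set S := ∑ i, v i ^ 2 with hS
  have hS0 : 0 ≤ S := sum_nonneg fun i _ => sq_nonneg _
  have hpos : ∀ k : ℕ, 0 < S + 1 + k := fun k => by positivity
  -- The scaling keeps these points in the ball because `S < (S + 1 + k) ^ 2`.
  refine Set.infinite_of_injective_forall_mem (f := fun k : ℕ => (r / (S + 1 + k)) • v + c) ?_ ?_
  · intro i j hij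
    have h1 := smul_left_injective ℝ hv0 (add_right_cancel hij)
    rw [div_eq_div_iff (hpos i).ne' (hpos j).ne'] at h1
    have h2 := mul_left_cancel₀ hr.ne' h1
    exact_mod_cast (add_left_cancel h2).symm
  · intro k
    refine hball _ (AffineSubspace.vadd_mem_of_mem_direction
      (Submodule.smul_mem _ _ hv) hc) ?_
    have h1 : ∑ i, (((r / (S + 1 + k)) • v + c) i - c i) ^ 2 = (r / (S + 1 + k)) ^ 2 * S := by
      rw [hS, mul_sum]
      exact sum_congr rfl fun i _ => by simp [mul_pow]
    rw [h1, div_pow, div_mul_eq_mul_div, div_lt_iff₀ (pow_pos (hpos k) 2)]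
    refine mul_lt_mul_of_pos_left ?_ (pow_pos hr 2)
    have : (0 : ℝ) ≤ k := by positivity
    nlinarith

end ParkingWords

theorem theorem1p1 (m n : ℕ) (hm : 1 ≤ m) (w : Fin n → Fin m) :
    ((∃ x, x ∈ ParkingWords.Fix w) ↔ ParkingWords.IsParkingWord w) ∧
    ((∃! x, x ∈ ParkingWords.Fix w) ↔ (ParkingWords.IsParkingWord w ∧ Nat.gcd m n = 1)) ∧
    ((ParkingWords.Fix w).Infinite ↔ (ParkingWords.IsParkingWord w ∧ 1 < Nat.gcd m n)) ∧
    (ParkingWords.Fix w = ∅ ↔ ¬ ParkingWords.IsParkingWord w) ∧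
    (ParkingWords.IsParkingWord w →
      ParkingWords.HasAffineDim (ParkingWords.Fix w) (Nat.gcd m n - 1)) := by
  have hex : (∃ x, x ∈ ParkingWords.Fix w) ↔ ParkingWords.IsParkingWord w :=
    ⟨fun ⟨_, hx⟩ => ParkingWords.isParkingWord_of_mem_Fix hm hx, ParkingWords.exists_mem_Fix hm⟩
  have hgcd : 0 < Nat.gcd m n := Nat.gcd_pos_of_pos_left n hm
  have hsub : ParkingWords.IsParkingWord w → Nat.gcd m n = 1 →
      (ParkingWords.Fix w).Subsingleton := fun hw h1 => by
    have h := ParkingWords.hasAffineDim_Fix hm hw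
    rw [h1] at h
    exact h.subsingleton
  have hinf : ParkingWords.IsParkingWord w → 1 < Nat.gcd m n →
      (ParkingWords.Fix w).Infinite := fun hw h1 =>
    (ParkingWords.hasAffineDim_Fix hm hw).infinite (by omega)
  refine ⟨hex, ⟨?_, ?_⟩, ⟨?_, fun h => hinf h.1 h.2⟩, ?_, ParkingWords.hasAffineDim_Fix hm⟩
  · intro h
    have hw := hex.1 h.exists
    refine ⟨hw, ?_⟩
    by_contra hne
    refine hinf hw (by omega) (Set.Subsingleton.finite fun x hx y hy => h.unique hx hy)
  · rintro ⟨hw, h1⟩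
    obtain ⟨x, hx⟩ := hex.2 hw
    exact ⟨x, hx, fun y hy => hsub hw h1 hy hx⟩
  · intro h
    have hw := hex.1 h.nonempty
    refine ⟨hw, ?_⟩
    by_contra hne
    exact h (hsub hw (by omega)).finite
  · rw [← hex, ← Set.not_nonempty_iff_eq_empty]
    rfl
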